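/- Let $(\varepsilon_n)$ be a sequence of positive numbers with $\varepsilon_n\to 0$. Then there exist a sequence $\Lambda=\{\lambda_n\}$ of positive real numbers with $$\frac{\lambda_{n+1}}{\lambda_n}>1+\varepsilon_n\quad\text{for all } n,$$ which is uniformly discrete, i.e. $\inf_{n\ne m}|\lambda_n-\lambda_m|>0$, and a function $g\in L^2(\mathbb R)$ (complex valued), such that the system of translates $u_n(t)=g(t-\lambda_n)$ is a (QF)-system in $L^2(\mathbb R)$, that is: (i) for every real $q>2$ there is a constant $C(q)$ such that for all $f\in L^2(\mathbb R)$ and $\epsilon>0$ there is a finite linear combination $Q=\sum_n c_nu_n$ with complex coefficients satisfying $\|f-Q\|<\epsilon$ and $\|\{c_n\}\|_{\ell_q}\le C(q)\|f\|$; (ii) (Bessel inequality) there is a constant $C'$ such that $\left(\sum_n|\langle f,u_n\rangle|^2\right)^{1/2}\le C'\|f\|$ for all $f\in L^2(\mathbb R)$. -/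

import Mathlib

open MeasureTheory Filter Topology

/-- A set of reals is uniformly discrete if distinct points are at distance at least some
fixed `δ > 0`. -/
def UniformlyDiscrete (S : Set ℝ) : Prop :=
  ∃ δ : ℝ, 0 < δ ∧ S.Pairwise fun x y => δ ≤ |x - y|

/-- The complex Hilbert space `L²(ℝ)` for Lebesgue measure. -/
abbrev L2R : Type := Lp ℂ 2 (volume : Measure ℝ)

/-- The translate `t ↦ g (t - a)` of `g ∈ L²(ℝ)`. -/
noncomputable def translateL2 (g : L2R) (a : ℝ) : L2R :=
  Lp.compMeasurePreserving (fun t : ℝ => t - a) (measurePreserving_sub_right volume a) g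

theorem coeFn_translateL2 (g : L2R) (a : ℝ) : translateL2 g a =ᵐ[volume] fun t => g (t - a) :=
  Lp.coeFn_compMeasurePreserving g (measurePreserving_sub_right volume a)

section QF

variable {ι H : Type*} [NormedAddCommGroup H] [InnerProductSpace ℂ H]

/-- The `ℓ_q` norm of a finitely supported family of complex numbers. -/
noncomputable def lqNorm (q : ℝ) (c : ι →₀ ℂ) : ℝ :=
  (c.sum fun _ z => ‖z‖ ^ q) ^ (1 / q)

/-- Completeness with `ℓ_q` estimate of coefficients, for the exponent `q`. -/
def CompleteWithLqEstimate (q : ℝ) (u : ι → H) : Prop :=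
  ∃ C : ℝ, ∀ f : H, ∀ ε : ℝ, 0 < ε →
    ∃ c : ι →₀ ℂ, ‖f - c.sum (fun n z => z • u n)‖ < ε ∧ lqNorm q c ≤ C * ‖f‖

/-- Bessel inequality (the convergence of the sum is part of the claim). -/
def IsBessel (u : ι → H) : Prop :=
  ∃ C : ℝ, ∀ f : H,
    Summable (fun n => ‖inner ℂ f (u n)‖ ^ 2) ∧
      Real.sqrt (∑' n, ‖inner ℂ f (u n)‖ ^ 2) ≤ C * ‖f‖

/-- `(QF)`-systems ("quasi-frames"). -/
def IsQF (u : ι → H) : Prop :=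
  (∀ q : ℝ, 2 < q → CompleteWithLqEstimate q u) ∧ IsBessel u

end QF

/-! On the Fourier side, translating `g` by `r + D j` multiplies `𝓕 g` by a character, so a
combination of such translates over `1 ≤ j ≤ N` is the translate by `r` multiplied by `P(-Dξ)`, with
`P` a polynomial of spectrum in `[1, N]`. If `P` is close to `1` and has small `ℓ_q` coefficients,
translates along the progression approximate the translate by `r` at little cost.

For `q > 2` such `P` exist with closeness in measure (`exists_analytic_trigPoly_near_one_lq`).
Dilation by `D ≠ 0` preserves measure on the circle, so `D` may be chosen afterwards, as large as
desired. The ratios along a progression of bounded length stay away from `1`, so if it is placed at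
late indices, where `ε` is tiny, the growth condition holds (`exists_almost_lacunary_seq`).

Closeness in measure becomes uniform after multiplication by one weight `0 < m ≤ 1`, by
Borel–Cantelli (`exists_multiplier`). Put `𝓕 g = m · 𝓕 1_[0,1)`. As `𝓕 g ≠ 0` a.e., rational
translates of `g` span a dense subspace (`span_rat_translates_dense`). Each rational is the offset
of infinitely many progressions, so each rational translate is approximated with coefficients
tending to `0` in `ℓ_q`. The Bessel inequality comes from the orthonormal translates of `1_[0,1)`,
the gaps being at least `1`, since `m` can be shifted onto `f`. -/

/-! ### Polynomials on the circle close to `1` in measure. -/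

/-- The trigonometric polynomial with spectrum in `S` and coefficients `c`. -/
noncomputable def trigPoly (S : Finset ℤ) (c : ℤ → ℂ) (x : UnitAddCircle) : ℂ :=
  ∑ j ∈ S, c j * fourier j x

theorem continuous_trigPoly (S : Finset ℤ) (c : ℤ → ℂ) : Continuous (trigPoly S c) := by
  unfold trigPoly
  fun_prop

theorem fourier_mul_index (a b : ℤ) (x : UnitAddCircle) :
    fourier (a * b) x = fourier b (a • x) := by
  rw [fourier_apply, fourier_apply, smul_smul, mul_comm]

theorem norm_fourier_apply (j : ℤ) (x : UnitAddCircle) : ‖(fourier j x : ℂ)‖ = 1 := by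
  rw [fourier_apply, Circle.norm_coe]

theorem fourier_natCast_eq_pow (n : ℕ) (x : UnitAddCircle) :
    (fourier (n : ℤ) x : ℂ) = (fourier 1 x : ℂ) ^ n := by
  induction n with
  | zero => simp
  | succ n ih => rw [Nat.cast_succ, fourier_add, ih, pow_succ]

theorem fourier_one_ne_one {x : UnitAddCircle} (hx : x ≠ 0) : (fourier 1 x : ℂ) ≠ 1 := by
  rw [fourier_one]
  intro h
  apply hx
  apply AddCircle.injective_toCircle (one_ne_zero : (1 : ℝ) ≠ 0)
  ext
  simpa using h

/-- On the unit circle conjugation is inversion, and the quotient plus its conjugate is `-1`. Hence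
`exp (s z / (1 - z))` has modulus `e^(-s/2)` on the circle although it equals `1` at the origin. -/
theorem re_div_one_sub {z : ℂ} (hz : ‖z‖ = 1) (h1 : z ≠ 1) : (z / (1 - z)).re = -1 / 2 := by
  have hz0 : z ≠ 0 := by rintro rfl; simp at hz
  have hc : (starRingEnd ℂ) z = z⁻¹ := by
    rw [Complex.inv_def, Complex.normSq_eq_norm_sq, hz]; simp
  have h2 : z / (1 - z) + (starRingEnd ℂ) (z / (1 - z)) = -1 := by
    rw [map_div₀, map_sub, map_one, hc]
    have h3 : 1 - z ≠ 0 := sub_ne_zero.mpr (Ne.symm h1)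
    have h4 : z - 1 ≠ 0 := sub_ne_zero.mpr h1
    have h5 : 1 - z⁻¹ ≠ 0 := by
      intro h; apply h1; rw [sub_eq_zero] at h; exact inv_eq_one.mp h.symm
    have h6 : z⁻¹ / (1 - z⁻¹) = 1 / (z - 1) := by
      rw [div_eq_div_iff h5 h4]; field_simp
    rw [h6]
    field_simp
    ring
  rw [Complex.add_conj] at h2
  have := congrArg Complex.re h2
  simp only [Complex.ofReal_re, Complex.neg_re, Complex.one_re] at this
  linarith

/-- The function `exp (s r z / (1 - r z))` is a uniform limit of polynomials with constant term `1`
on the unit circle. -/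
theorem exists_polynomial_near_exp (s r : ℝ) (hr0 : 0 < r) (hr1 : r < 1) {η : ℝ} (hη : 0 < η) :
    ∃ (n : ℕ) (a : ℕ → ℂ), ∀ z : ℂ, ‖z‖ = 1 →
      ‖Complex.exp (s * (r * z / (1 - r * z))) - (1 + ∑ k ∈ Finset.Icc 1 n, a k * z ^ k)‖ < η := by
  -- Radii `1 < R' < R < 1/r`: the function is holomorphic on the closed `R`-disc, so its Taylor
  -- sums converge uniformly on the `R'`-disc, which contains the unit circle.
  obtain ⟨R, hR1, hR2⟩ := exists_between ((one_lt_inv₀ hr0).mpr hr1)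
  obtain ⟨R', hR'1, hR'2⟩ := exists_between hR1
  lift R to NNReal using by linarith
  lift R' to NNReal using by linarith
  set f : ℂ → ℂ := fun z => Complex.exp (s * (r * z / (1 - r * z))) with hf
  have hd : DifferentiableOn ℂ f (Metric.closedBall 0 R) := by
    intro z hz
    rw [mem_closedBall_zero_iff] at hz
    have : 1 - (r : ℂ) * z ≠ 0 := by
      intro h
      have h' : (r : ℂ) * z = 1 := (sub_eq_zero.mp h).symm
      have h2 : r * ‖z‖ = 1 := by
        have := congrArg norm h'
        rwa [norm_mul, Complex.norm_real, Real.norm_of_nonneg hr0.le, norm_one] at this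
      have : r * ‖z‖ < r * r⁻¹ := by gcongr; exact hz.trans_lt hR2
      rw [mul_inv_cancel₀ hr0.ne'] at this
      linarith
    apply DifferentiableAt.differentiableWithinAt
    simp only [hf]
    fun_prop (disch := assumption)
  have hp := hd.hasFPowerSeriesOnBall (by exact_mod_cast (zero_lt_one.trans hR1))
  set p := cauchyPowerSeries f 0 R
  have hu := hp.tendstoUniformlyOn (r' := R') (by exact_mod_cast hR'2)
  rw [Metric.tendstoUniformlyOn_iff] at hu
  obtain ⟨n, hn⟩ := ((hu η hη).and (eventually_ge_atTop 1)).exists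
  obtain ⟨m, rfl⟩ : ∃ m, n = m + 1 := ⟨n - 1, by omega⟩
  refine ⟨m, fun k => p.coeff k, fun z hz => ?_⟩
  have := hn.1 z (by rw [mem_ball_zero_iff, hz]; exact hR'1)
  rw [dist_eq_norm, zero_add] at this
  convert! this using 2
  simp only [hf]
  congr 1
  rw [FormalMultilinearSeries.partialSum, Finset.range_eq_Ico, Finset.sum_eq_sum_Ico_succ_bot (by omega)]
  congr 1
  · rw [hp.coeff_zero]; simp [hf]
  · rw [← Finset.Ico_add_one_right_eq_Icc]
    refine Finset.sum_congr rfl fun k _ => ?_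
    rw [FormalMultilinearSeries.apply_eq_pow_smul_coeff, smul_eq_mul, mul_comm]

/-- There are trigonometric polynomials with positive spectrum which are close to `1` in measure. -/
theorem exists_analytic_trigPoly_near_one {η : ℝ} (hη : 0 < η) :
    ∃ (S : Finset ℤ) (b : ℤ → ℂ), (∀ j ∈ S, 1 ≤ j) ∧
      volume {x | η < ‖trigPoly S b x - 1‖} ≤ ENNReal.ofReal η := by
  obtain ⟨s, hs⟩ : ∃ s : ℝ, Real.exp (-s / 2) < η / 3 := by
    refine ⟨-2 * (Real.log (η / 3) - 1), ?_⟩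
    rw [← Real.lt_log_iff_exp_lt (by positivity)]
    linarith
  let r : ℕ → ℝ := fun k => 1 - 1 / ((k : ℝ) + 2)
  have hr0 : ∀ k, 0 < r k := fun k => by
    have : 1 / ((k : ℝ) + 2) < 1 := by
      rw [div_lt_one (by positivity)]; have := k.cast_nonneg (α := ℝ); linarith
    simp only [r]; linarith
  have hr1 : ∀ k, r k < 1 := fun k => by
    have : 0 < 1 / ((k : ℝ) + 2) := by positivity
    simp only [r]; linarith
  have hrlim : Tendsto r atTop (𝓝 1) := by
    have h1 : Tendsto (fun k : ℕ => 1 / ((k : ℝ) + 2)) atTop (𝓝 0) := by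
      have : Tendsto (fun k : ℕ => (k : ℝ) + 2) atTop atTop :=
        tendsto_atTop_add_const_right _ _ tendsto_natCast_atTop_atTop
      simpa [Function.comp_def] using tendsto_inv_atTop_zero.comp this
    simpa only [sub_zero] using h1.const_sub (1 : ℝ)
  let H : ℕ → UnitAddCircle → ℂ := fun k x =>
    Complex.exp (s * (r k * fourier 1 x / (1 - r k * fourier 1 x)))
  let H' : UnitAddCircle → ℂ := fun x => Complex.exp (s * (fourier 1 x / (1 - fourier 1 x)))
  have hmeas : ∀ k, AEStronglyMeasurable (H k) volume := fun k => by
    apply Measurable.aestronglyMeasurable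
    have : Measurable (fun x : UnitAddCircle => (fourier 1 x : ℂ)) :=
      (map_continuous (fourier 1)).measurable
    fun_prop
  have hae : ∀ᵐ x : UnitAddCircle, x ≠ 0 := by
    rw [ae_iff]
    simpa using AddCircle.volume_closedBall (1 : ℝ) (x := 0) 0
  have hlim : TendstoInMeasure volume H atTop H' := by
    refine tendstoInMeasure_of_tendsto_ae hmeas ?_
    filter_upwards [hae] with x hx
    have h1 : 1 - (fourier 1 x : ℂ) ≠ 0 := sub_ne_zero.mpr (Ne.symm (fourier_one_ne_one hx))
    have h2 : Tendsto (fun k => (r k : ℂ)) atTop (𝓝 ((1 : ℝ) : ℂ)) :=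
      (Complex.continuous_ofReal.tendsto _).comp hrlim
    have h3 : Tendsto (fun k => (r k : ℂ) * fourier 1 x) atTop (𝓝 (fourier 1 x)) := by
      simpa using h2.mul_const (fourier 1 x : ℂ)
    exact (Complex.continuous_exp.tendsto _).comp
      ((h3.div (h3.const_sub 1) h1).const_mul (s : ℂ))
  have hlim' := hlim (ENNReal.ofReal (η / 3)) (by simpa using by positivity)
  obtain ⟨k, hk⟩ := (hlim'.eventually_le_const (ENNReal.ofReal_pos.mpr hη)).exists
  obtain ⟨n, a, ha⟩ := exists_polynomial_near_exp s (r k) (hr0 k) (hr1 k) (η := η / 3) (by positivity)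
  -- The exponential is small on the circle and has constant term `1`; the polynomial taken is `1`
  -- minus its Taylor sum.
  refine ⟨(Finset.Icc 1 n).map Nat.castEmbedding, fun j => -a j.toNat, ?_, ?_⟩
  · intro j hj
    simp only [Finset.mem_map, Finset.mem_Icc, Nat.castEmbedding_apply] at hj
    obtain ⟨i, hi, rfl⟩ := hj
    exact_mod_cast hi.1
  refine le_trans (measure_mono_ae ?_) hk
  filter_upwards [hae] with x hx hx2
  by_contra hcon
  replace hcon : ¬ (ENNReal.ofReal (η / 3) ≤ edist (H k x) (H' x)) := hcon
  rw [not_le, edist_dist, ENNReal.ofReal_lt_ofReal_iff (by positivity), dist_eq_norm] at hcon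
  have h1 : ‖H' x‖ < η / 3 := by
    simp only [H', Complex.norm_exp]
    rw [Complex.re_ofReal_mul, re_div_one_sub (norm_fourier_apply _ _) (fourier_one_ne_one hx)]
    convert hs using 2; ring
  have h2 := ha (fourier 1 x) (norm_fourier_apply _ _)
  have h3 : trigPoly ((Finset.Icc 1 n).map Nat.castEmbedding) (fun j => -a j.toNat) x
      = -∑ k ∈ Finset.Icc 1 n, a k * (fourier 1 x : ℂ) ^ k := by
    simp only [trigPoly, Finset.sum_map, Nat.castEmbedding_apply, Int.toNat_natCast,
      fourier_natCast_eq_pow, neg_mul, Finset.sum_neg_distrib]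
  replace hx2 : η < ‖_‖ := hx2
  rw [h3] at hx2
  have h4 : -∑ k ∈ Finset.Icc 1 n, a k * (fourier 1 x : ℂ) ^ k - 1
    = (H k x - (1 + ∑ k ∈ Finset.Icc 1 n, a k * (fourier 1 x : ℂ) ^ k)) - (H k x - H' x) - H' x := by
    ring
  rw [h4] at hx2
  have h5 := norm_sub_le
    (H k x - (1 + ∑ k ∈ Finset.Icc 1 n, a k * (fourier 1 x : ℂ) ^ k) - (H k x - H' x)) (H' x)
  have h6 := norm_sub_le
    (H k x - (1 + ∑ k ∈ Finset.Icc 1 n, a k * (fourier 1 x : ℂ) ^ k)) (H k x - H' x)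
  simp only [H] at h2 h5 h6 hx2 hcon
  linarith

theorem exists_extension_of_injOn {α : Type*} [Nonempty α] {S : Finset α} {φ : α → ℤ}
    (hφ : Set.InjOn φ S) (c : α → ℂ) : ∃ c' : ℤ → ℂ, ∀ p ∈ S, c' (φ p) = c p :=
  ⟨c ∘ Function.invFunOn φ S, fun p hp => by
    simp only [Function.comp_apply]
    rw [hφ.leftInvOn_invFunOn hp]⟩

theorem haarAddCircle_one_eq_volume :
    (AddCircle.haarAddCircle : Measure UnitAddCircle) = volume := by
  rw [AddCircle.volume_eq_smul_haarAddCircle]; simp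

/-- Partial Fourier sums of a normalised indicator of a short arc. -/
theorem exists_trigPoly_concentrated {κ η : ℝ} (hκ : 0 < κ) (hκ1 : κ ≤ 1) (hη : 0 < η) :
    ∃ (S : Finset ℤ) (c : ℤ → ℂ), 0 ∉ S ∧ (∀ j ∈ S, ‖c j‖ ≤ 1) ∧
      ∑ j ∈ S, ‖c j‖ ^ 2 ≤ 1 / κ ∧
      volume {x | η < ‖1 + trigPoly S c x‖} ≤ ENNReal.ofReal (2 * κ) := by
  rw [← haarAddCircle_one_eq_volume]
  set μ : Measure UnitAddCircle := AddCircle.haarAddCircle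
  set E : Set UnitAddCircle := Metric.closedBall 0 (κ / 2)
  have hE : MeasurableSet E := Metric.isClosed_closedBall.measurableSet
  have hμE : μ E = ENNReal.ofReal κ := by
    simp only [μ, E]
    rw [haarAddCircle_one_eq_volume, AddCircle.volume_closedBall]
    congr 1
    rw [mul_div_cancel₀ _ two_ne_zero, min_eq_right hκ1]
  have hμE' : μ.real E = κ := by rw [measureReal_def, hμE, ENNReal.toReal_ofReal hκ.le]
  -- Height `1/κ` on an arc of measure `κ`: the zeroth coefficient is `1`, all are at most `1` in
  -- modulus, and Parseval gives energy `1/κ`. The sums are small off the arc and a further set of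
  -- measure `κ`, hence `2κ`.
  set f : Lp ℂ 2 μ := indicatorConstLp 2 hE (measure_ne_top μ E) ((1 / κ : ℝ) : ℂ)
  have hf : f =ᵐ[μ] E.indicator fun _ => ((1 / κ : ℝ) : ℂ) := indicatorConstLp_coeFn
  have hnorm1 : ∫ t, ‖f t‖ ∂μ = 1 := by
    have : (fun t => ‖f t‖) =ᵐ[μ] E.indicator fun _ => 1 / κ := by
      filter_upwards [hf] with t ht
      rw [ht, norm_indicator_eq_indicator_norm]
      simp [abs_of_pos hκ]
    rw [integral_congr_ae this, integral_indicator_const _ hE, hμE', smul_eq_mul,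
      mul_one_div_cancel hκ.ne']
  have hnorm2 : ∫ t, ‖f t‖ ^ 2 ∂μ = 1 / κ := by
    have : (fun t => ‖f t‖ ^ 2) =ᵐ[μ] E.indicator fun _ => (1 / κ) ^ 2 := by
      filter_upwards [hf] with t ht
      rw [ht]
      by_cases h : t ∈ E <;> simp [h]
    rw [integral_congr_ae this, integral_indicator_const _ hE, hμE', smul_eq_mul]
    field_simp
  have hc0 : fourierCoeff f 0 = 1 := by
    have : (fun t => (fourier (-0) t : ℂ) • f t) =ᵐ[μ] E.indicator fun _ => ((1 / κ : ℝ) : ℂ) := by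
      filter_upwards [hf] with t ht
      simp [ht]
    rw [fourierCoeff, integral_congr_ae this, integral_indicator_const _ hE, hμE',
      Complex.real_smul, ← Complex.ofReal_mul, mul_one_div_cancel hκ.ne', Complex.ofReal_one]
  have hc1 : ∀ j, ‖fourierCoeff f j‖ ≤ 1 := fun j => by
    refine (norm_integral_le_integral_norm _).trans_eq ?_
    simp_rw [norm_smul, norm_fourier_apply, one_mul]
    exact hnorm1
  have hsq := hasSum_sq_fourierCoeff f
  rw [hnorm2] at hsq
  have hlim := tendstoInMeasure_of_tendsto_Lp (hasSum_fourier_series_L2 f)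
  have hlim' := hlim (ENNReal.ofReal η) (ENNReal.ofReal_pos.mpr hη)
  obtain ⟨S, hS1, hS2⟩ := ((hlim'.eventually_le_const (ENNReal.ofReal_pos.mpr hκ)).and
    (eventually_ge_atTop {0})).exists
  have h0S : (0 : ℤ) ∈ S := Finset.singleton_subset_iff.mp hS2
  refine ⟨S.erase 0, fourierCoeff f, Finset.notMem_erase _ _, fun j _ => hc1 j, ?_, ?_⟩
  · exact sum_le_hasSum _ (fun _ _ => by positivity) hsq
  have hsum : (∑ i ∈ S, fourierCoeff f i • fourierLp (T := 1) 2 i : Lp ℂ 2 μ) =ᵐ[μ]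
      fun x => 1 + trigPoly (S.erase 0) (fourierCoeff f) x := by
    have h1 : ∀ᵐ x ∂μ, ∀ i : ℤ, (fourierLp (T := 1) 2 i : UnitAddCircle → ℂ) x = fourier i x :=
      ae_all_iff.mpr fun i => coeFn_fourierLp 2 i
    have h2 : ∀ᵐ x ∂μ, ∀ i : ℤ, (fourierCoeff f i • fourierLp (T := 1) 2 i : Lp ℂ 2 μ) x =
        fourierCoeff f i * (fourierLp (T := 1) 2 i : UnitAddCircle → ℂ) x :=
      ae_all_iff.mpr fun i => Lp.coeFn_smul _ _
    filter_upwards [h1, h2, Lp.coeFn_finsetSum S fun i => fourierCoeff f i • fourierLp (T := 1) 2 i]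
      with x hx1 hx2 hx3
    rw [hx3, Finset.sum_apply, ← Finset.add_sum_erase _ _ h0S, hx2, hx1, hc0, fourier_zero,
      mul_one]
    congr 1
    exact Finset.sum_congr rfl fun i _ => by rw [hx2, hx1]
  have hsub : {x | η < ‖1 + trigPoly (S.erase 0) (fourierCoeff f) x‖} ≤ᵐ[μ]
      ({x | ENNReal.ofReal η ≤
        edist ((∑ i ∈ S, fourierCoeff f i • fourierLp (T := 1) 2 i : Lp ℂ 2 μ) x) (f x)} ∪ E :
        Set UnitAddCircle) := by
    filter_upwards [hsum, hf] with x hx1 hx2 hx3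
    by_cases hxE : x ∈ E
    · exact Or.inr hxE
    · left
      change _ ≤ edist _ _
      rw [hx1, hx2, Set.indicator_of_notMem hxE, edist_zero_right, ← ofReal_norm]
      exact ENNReal.ofReal_le_ofReal (le_of_lt hx3)
  calc _ ≤ _ := measure_mono_ae hsub
    _ ≤ _ := measure_union_le _ _
    _ ≤ ENNReal.ofReal κ + ENNReal.ofReal κ := add_le_add hS1 hμE.le
    _ = _ := by rw [← ENNReal.ofReal_add hκ.le hκ.le, two_mul]

theorem volume_preimage_zsmul {n : ℤ} (hn : n ≠ 0) {s : Set UnitAddCircle} (hs : MeasurableSet s) :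
    volume ((fun x : UnitAddCircle => n • x) ⁻¹' s) = volume s :=
  (Measure.measurePreserving_zsmul volume hn).measure_preimage hs.nullMeasurableSet

theorem measurableSet_lt_norm_trigPoly_sub (S : Finset ℤ) (c : ℤ → ℂ) (w : ℂ) (η : ℝ) :
    MeasurableSet {x | η < ‖trigPoly S c x - w‖} :=
  (isOpen_lt continuous_const ((continuous_trigPoly S c).sub continuous_const).norm).measurableSet

/-- For `q > 2` there are trigonometric polynomials without constant term which are close to `1`
in measure and have small coefficients in `ℓ_q`. -/
theorem exists_trigPoly_near_one {q η : ℝ} (hq : 2 < q) (hη : 0 < η) :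
    ∃ (S : Finset ℤ) (c : ℤ → ℂ), 0 ∉ S ∧ ∑ j ∈ S, ‖c j‖ ^ q ≤ η ∧
      volume {x | η < ‖trigPoly S c x - 1‖} ≤ ENNReal.ofReal η := by
  set δ := min η 1 / 2
  have hδ : 0 < δ := by positivity
  have hδη : 2 * δ ≤ η := by simp only [δ]; linarith [min_le_left η 1]
  have hδ1 : δ ≤ 1 := by simp only [δ]; linarith [min_le_right η 1]
  obtain ⟨m, hm0, hm⟩ : ∃ m : ℕ, 1 ≤ m ∧ (m : ℝ) ^ (-(q - 2)) ≤ η * δ := by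
    have h := (tendsto_rpow_neg_atTop (y := q - 2) (by linarith)).comp
      (tendsto_natCast_atTop_atTop (R := ℝ))
    exact ((eventually_ge_atTop 1).and
      (h.eventually_le_const (show 0 < η * δ by positivity))).exists
  have hm0' : (0 : ℝ) < m := by exact_mod_cast hm0
  have hm1' : (1 : ℝ) ≤ m := by exact_mod_cast hm0
  -- Average `m` dilates with disjoint spectra. With `κ = δ/m` the exceptional sets have total
  -- measure at most `2δ`, while `|c|^q ≤ |c|^2` bounds the coefficient sum by `m · m^(-q) · m/δ =
  -- m^(2-q)/δ`.
  obtain ⟨S, c, hS0, hc1, hc2, hvol⟩ := exists_trigPoly_concentrated (κ := δ / m) (η := η)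
    (by positivity) ((div_le_self hδ.le hm1').trans hδ1) hη
  obtain ⟨N, hN⟩ : ∃ N : ℕ, ∀ j ∈ S, j.natAbs ≤ N :=
    ⟨S.sup Int.natAbs, fun j hj => Finset.le_sup (f := Int.natAbs) hj⟩
  -- The base `N + 1` exceeds every frequency in `S`, and `0 ∉ S`, so distinct dilates share no
  -- frequency.
  let φ : ℕ × ℤ → ℤ := fun p => ((N : ℤ) + 1) ^ p.1 * p.2
  have hφ0 : ∀ p ∈ Finset.range m ×ˢ S, φ p ≠ 0 := by
    intro p hp
    have h2 : p.2 ≠ 0 := fun h => hS0 (h ▸ (Finset.mem_product.mp hp).2)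
    exact mul_ne_zero (pow_ne_zero _ (by positivity)) h2
  have hlt : ∀ a b : ℕ, ∀ i ∈ S, ∀ j ∈ S, a < b → φ (a, i) ≠ φ (b, j) := by
    intro a b i hi j hj hab h
    obtain ⟨d, rfl⟩ := Nat.exists_eq_add_of_lt hab
    have hj0 : j ≠ 0 := fun h => hS0 (h ▸ hj)
    have h1 : i = ((N : ℤ) + 1) ^ (d + 1) * j := by
      apply mul_left_cancel₀ (pow_ne_zero a (by positivity : (N : ℤ) + 1 ≠ 0))
      rw [← mul_assoc, ← pow_add]
      exact h
    have h2 : i.natAbs = (N + 1) ^ (d + 1) * j.natAbs := by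
      have := congrArg Int.natAbs h1
      rw [Int.natAbs_mul, Int.natAbs_pow] at this
      exact this
    have h3 : N + 1 ≤ i.natAbs := by
      rw [h2, pow_succ, mul_right_comm]
      exact Nat.le_mul_of_pos_left _ (Nat.mul_pos (by positivity) (Int.natAbs_pos.mpr hj0))
    have := hN i hi
    omega
  have hinj : Set.InjOn φ (Finset.range m ×ˢ S : Finset (ℕ × ℤ)) := by
    rintro ⟨a, i⟩ hp ⟨b, j⟩ hp' h
    have hi := (Finset.mem_product.mp hp).2
    have hj := (Finset.mem_product.mp hp').2
    rcases lt_trichotomy a b with hab | hab | hab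
    · exact absurd h (hlt a b i hi j hj hab)
    · subst hab
      have := mul_left_cancel₀ (pow_ne_zero a (by positivity : (N : ℤ) + 1 ≠ 0)) h
      simp only at this
      rw [this]
    · exact absurd h.symm (hlt b a j hj i hi hab)
  obtain ⟨c', hc'⟩ := exists_extension_of_injOn hinj fun p => -(1 / (m : ℂ)) * c p.2
  refine ⟨(Finset.range m ×ˢ S).image φ, c', ?_, ?_, ?_⟩
  · rw [Finset.mem_image]
    rintro ⟨p, hp, hp0⟩
    exact hφ0 p hp hp0
  · rw [Finset.sum_image hinj]
    have h1 : ∀ p ∈ Finset.range m ×ˢ S, ‖c' (φ p)‖ ^ q ≤ (m : ℝ) ^ (-q) * ‖c p.2‖ ^ 2 := by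
      intro p hp
      rw [hc' p hp, norm_mul, Real.mul_rpow (norm_nonneg _) (norm_nonneg _)]
      have h2 : ‖-(1 / (m : ℂ))‖ = (m : ℝ)⁻¹ := by simp
      rw [h2, Real.inv_rpow hm0'.le, Real.rpow_neg hm0'.le]
      gcongr
      rw [← Real.rpow_natCast]
      rcases eq_or_lt_of_le (norm_nonneg (c p.2)) with h0 | h0
      · rw [← h0, Real.zero_rpow (by linarith), Real.zero_rpow (by norm_num)]
      · exact Real.rpow_le_rpow_of_exponent_ge h0 (hc1 _ (Finset.mem_product.mp hp).2)
          (by norm_num; exact hq.le)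
    calc _ ≤ ∑ p ∈ Finset.range m ×ˢ S, (m : ℝ) ^ (-q) * ‖c p.2‖ ^ 2 := Finset.sum_le_sum h1
      _ = m * ((m : ℝ) ^ (-q) * ∑ j ∈ S, ‖c j‖ ^ 2) := by
        rw [Finset.sum_product, Finset.mul_sum]; simp
      _ ≤ m * ((m : ℝ) ^ (-q) * (1 / (δ / m))) := by gcongr
      _ = (m : ℝ) ^ (-(q - 2)) / δ := by
        have : (m : ℝ) ^ (-(q - 2)) = m ^ (-q) * m ^ 2 := by
          rw [← Real.rpow_natCast, ← Real.rpow_add hm0']; congr 1; push_cast; ring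
        rw [this]; field_simp
      _ ≤ η := by rw [div_le_iff₀ hδ]; exact hm
  · have hsum : ∀ x, trigPoly ((Finset.range m ×ˢ S).image φ) c' x - 1 =
        -(1 / (m : ℂ)) * ∑ i ∈ Finset.range m, (1 + trigPoly S c (((N : ℤ) + 1) ^ i • x)) := by
      intro x
      have h1 : trigPoly ((Finset.range m ×ˢ S).image φ) c' x =
          -(1 / (m : ℂ)) * ∑ i ∈ Finset.range m, trigPoly S c (((N : ℤ) + 1) ^ i • x) := by
        simp only [trigPoly]
        rw [Finset.sum_image hinj, Finset.sum_congr rfl fun p hp => by rw [hc' p hp],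
          Finset.sum_product, Finset.mul_sum]
        refine Finset.sum_congr rfl fun i _ => ?_
        rw [Finset.mul_sum]
        refine Finset.sum_congr rfl fun j _ => ?_
        simp only [φ]
        rw [fourier_mul_index, mul_assoc]
      rw [h1, Finset.sum_add_distrib, mul_add]
      have : (m : ℂ) ≠ 0 := by exact_mod_cast hm0'.ne'
      simp only [Finset.sum_const, Finset.card_range, nsmul_eq_mul, mul_one]
      field_simp
      ring
    have hsub : {x | η < ‖trigPoly ((Finset.range m ×ˢ S).image φ) c' x - 1‖} ⊆
        ⋃ i ∈ Finset.range m, (fun x : UnitAddCircle => ((N : ℤ) + 1) ^ i • x) ⁻¹'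
          {x | η < ‖1 + trigPoly S c x‖} := by
      intro x hx
      by_contra hcon
      simp only [Set.mem_iUnion, Set.mem_preimage, Set.mem_ofPred_eq, not_exists, not_lt] at hcon
      rw [Set.mem_ofPred_eq, hsum, norm_mul] at hx
      have h2 : ‖-(1 / (m : ℂ))‖ = (m : ℝ)⁻¹ := by simp
      have h3 : ‖∑ i ∈ Finset.range m, (1 + trigPoly S c (((N : ℤ) + 1) ^ i • x))‖ ≤ m * η := by
        refine (norm_sum_le_of_le _ hcon).trans_eq ?_
        simp
      rw [h2, inv_mul_eq_div, lt_div_iff₀ hm0'] at hx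
      linarith
    have hmeas : MeasurableSet {x | η < ‖1 + trigPoly S c x‖} :=
      (isOpen_lt continuous_const
        (continuous_const.add (continuous_trigPoly S c)).norm).measurableSet
    calc _ ≤ _ := measure_mono hsub
      _ ≤ _ := measure_biUnion_finset_le _ _
      _ ≤ ∑ i ∈ Finset.range m, ENNReal.ofReal (2 * (δ / m)) := by
        refine Finset.sum_le_sum fun i _ => ?_
        rw [volume_preimage_zsmul (pow_ne_zero _ (by positivity)) hmeas]
        exact hvol
      _ = ENNReal.ofReal (2 * δ) := by
        rw [Finset.sum_const, Finset.card_range, nsmul_eq_mul, ← ENNReal.ofReal_natCast,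
          ← ENNReal.ofReal_mul hm0'.le]
        congr 1; field_simp
      _ ≤ _ := ENNReal.ofReal_le_ofReal hδη

theorem sum_Icc_ite_mem_eq_sum {M : Type*} [AddCommMonoid M] {T : Finset ℤ}
    (hT : ∀ j ∈ T, 1 ≤ j) (F : ℤ → M) :
    ∑ j ∈ Finset.Icc 1 (T.sup Int.toNat), (if (j : ℤ) ∈ T then F j else 0) = ∑ j ∈ T, F j := by
  rw [← Finset.sum_filter]
  refine Finset.sum_nbij' (fun j => (j : ℤ)) Int.toNat ?_ ?_ ?_ ?_ ?_
  · intro j hj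
    exact (Finset.mem_filter.mp hj).2
  · intro j hj
    have h1 := hT j hj
    have h2 : ((j.toNat : ℕ) : ℤ) = j := Int.toNat_of_nonneg (by omega)
    have h3 : j.toNat ≤ T.sup Int.toNat := Finset.le_sup (f := Int.toNat) hj
    rw [Finset.mem_filter, Finset.mem_Icc, h2]
    exact ⟨⟨by omega, h3⟩, hj⟩
  · intro j _
    simp
  · intro j hj
    exact Int.toNat_of_nonneg (by have := hT j hj; omega)
  · intro j _
    rfl

/-- For `q > 2` there are trigonometric polynomials with positive spectrum which are close to `1`
in measure and have small coefficients in `ℓ_q`. -/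
theorem exists_analytic_trigPoly_near_one_lq {q η : ℝ} (hq : 2 < q) (hη : 0 < η) :
    ∃ (N : ℕ) (c : ℕ → ℂ), ∑ j ∈ Finset.Icc 1 N, ‖c j‖ ^ q ≤ η ∧
      volume {x : UnitAddCircle |
        η < ‖∑ j ∈ Finset.Icc 1 N, c j * fourier (j : ℤ) x - 1‖} ≤ ENNReal.ofReal η := by
  set δ := min (η / 3) 1
  have hδ : 0 < δ := by positivity
  have hδη : 3 * δ ≤ η := by linarith [min_le_left (η / 3) 1]
  have hδ1 : δ ≤ 1 := min_le_right _ _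
  obtain ⟨S, b, hS, hb⟩ := exists_analytic_trigPoly_near_one hδ
  set M := ∑ j ∈ S, ‖b j‖ ^ q
  have hM : 0 ≤ M := Finset.sum_nonneg fun _ _ => by positivity
  -- The analytic factor `b` is fixed first; `c` is then taken so small that the product, whose
  -- `ℓ_q` sum is `M` times that of `c`, stays below `η`.
  set θ := min δ (η / (1 + M))
  have hθ : 0 < θ := by positivity
  obtain ⟨R, c, hR, hcq, hc⟩ := exists_trigPoly_near_one hq hθ
  obtain ⟨N, hN⟩ : ∃ N : ℕ, ∀ j ∈ R, |j| ≤ N :=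
    ⟨R.sup Int.natAbs, fun j hj => by
      rw [Int.abs_eq_natAbs]; exact_mod_cast Finset.le_sup (f := Int.natAbs) hj⟩
  -- Dilation by `2N + 1` keeps the shifted copies of `R ⊆ [-N, N]` disjoint, and positive since `b`
  -- has spectrum in `[1, ∞)`.
  let φ : ℤ × ℤ → ℤ := fun p => (2 * N + 1) * p.1 + p.2
  have hinj : Set.InjOn φ (S ×ˢ R : Finset (ℤ × ℤ)) := by
    rintro ⟨a, i⟩ hp ⟨b, j⟩ hp' h
    have hi := abs_le.mp (hN i (Finset.mem_product.mp hp).2)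
    have hj := abs_le.mp (hN j (Finset.mem_product.mp hp').2)
    simp only [φ] at h
    have hab : a = b := by
      rcases lt_trichotomy a b with hab | hab | hab
      · nlinarith
      · exact hab
      · nlinarith
    subst hab
    simpa using h
  have hpos : ∀ p ∈ S ×ˢ R, 1 ≤ φ p := by
    rintro ⟨a, i⟩ hp
    have hi := abs_le.mp (hN i (Finset.mem_product.mp hp).2)
    have ha := hS a (Finset.mem_product.mp hp).1
    simp only [φ]
    nlinarith
  obtain ⟨d, hd⟩ := exists_extension_of_injOn hinj fun p => b p.1 * c p.2
  set T := (S ×ˢ R).image φ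
  have hT : ∀ j ∈ T, 1 ≤ j := by
    intro j hj
    obtain ⟨p, hp, rfl⟩ := Finset.mem_image.mp hj
    exact hpos p hp
  refine ⟨T.sup Int.toNat, fun j => if (j : ℤ) ∈ T then d j else 0, ?_, ?_⟩
  · have h1 : ∀ j : ℕ, ‖(if (j : ℤ) ∈ T then d j else 0)‖ ^ q =
        if (j : ℤ) ∈ T then ‖d j‖ ^ q else 0 := by
      intro j
      split_ifs
      · rfl
      · rw [norm_zero, Real.zero_rpow (by linarith)]
    simp_rw [h1]
    rw [sum_Icc_ite_mem_eq_sum hT fun j => ‖d j‖ ^ q, Finset.sum_image hinj]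
    have h2 : ∑ p ∈ S ×ˢ R, ‖d (φ p)‖ ^ q = M * ∑ j ∈ R, ‖c j‖ ^ q := by
      rw [Finset.sum_mul_sum, ← Finset.sum_product']
      refine Finset.sum_congr rfl fun p hp => ?_
      rw [hd p hp, norm_mul, Real.mul_rpow (norm_nonneg _) (norm_nonneg _)]
    rw [h2]
    calc M * ∑ j ∈ R, ‖c j‖ ^ q ≤ M * (η / (1 + M)) := by
          gcongr
          exact hcq.trans (min_le_right _ _)
      _ ≤ (1 + M) * (η / (1 + M)) := by gcongr; linarith
      _ = η := by field_simp
  · have h1 : ∀ x : UnitAddCircle, ∑ j ∈ Finset.Icc 1 (T.sup Int.toNat),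
        (if (j : ℤ) ∈ T then d j else 0) * fourier (j : ℤ) x =
          trigPoly S b ((2 * N + 1 : ℤ) • x) * trigPoly R c x := by
      intro x
      simp_rw [ite_mul, zero_mul]
      rw [sum_Icc_ite_mem_eq_sum hT fun j => d j * fourier j x, Finset.sum_image hinj, trigPoly,
        trigPoly, Finset.sum_mul_sum, ← Finset.sum_product']
      refine Finset.sum_congr rfl fun p hp => ?_
      rw [hd p hp]
      simp only [φ]
      rw [fourier_add, fourier_mul_index]
      ring
    simp_rw [h1]
    have hsub : {x | η < ‖trigPoly S b ((2 * N + 1 : ℤ) • x) * trigPoly R c x - 1‖} ⊆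
        (fun x : UnitAddCircle => (2 * N + 1 : ℤ) • x) ⁻¹' {x | δ < ‖trigPoly S b x - 1‖} ∪
          {x | θ < ‖trigPoly R c x - 1‖} := by
      intro x hx
      by_contra hcon
      simp only [Set.mem_union, Set.mem_preimage, Set.mem_ofPred_eq, not_or, not_lt] at hcon hx
      obtain ⟨hA, hB⟩ := hcon
      replace hB := hB.trans (min_le_left _ _)
      set u := trigPoly S b ((2 * N + 1 : ℤ) • x)
      set v := trigPoly R c x
      have h2 : u * v - 1 = (u - 1) * (v - 1) + (u - 1) + (v - 1) := by ring
      have h3 : ‖u * v - 1‖ ≤ ‖u - 1‖ * ‖v - 1‖ + ‖u - 1‖ + ‖v - 1‖ := by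
        rw [h2]
        refine (norm_add_le _ _).trans (add_le_add_left ((norm_add_le _ _).trans ?_) _)
        rw [norm_mul]
      have h4 : ‖u - 1‖ * ‖v - 1‖ ≤ δ * 1 := by
        gcongr
        exact hB.trans hδ1
      linarith
    calc _ ≤ _ := measure_mono hsub
      _ ≤ _ := measure_union_le _ _
      _ ≤ ENNReal.ofReal δ + ENNReal.ofReal δ := by
        rw [volume_preimage_zsmul (by positivity) (measurableSet_lt_norm_trigPoly_sub S b 1 δ)]
        exact add_le_add hb (hc.trans (ENNReal.ofReal_le_ofReal (min_le_left _ _)))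
      _ = ENNReal.ofReal (δ + δ) := (ENNReal.ofReal_add hδ.le hδ.le).symm
      _ ≤ _ := ENNReal.ofReal_le_ofReal (by linarith)

/-! ### Almost lacunary sequences containing long progressions. -/

open Classical in
/-- A sequence of pairs (term, current difference): at the indices in `cont` it continues the
current arithmetic progression, at every other index `n` it starts a new one, of the form
`ν n + D j` with `D` large. -/
noncomputable def progressionSeq (ε ν : ℕ → ℝ) (cont : Set ℕ) : ℕ → ℝ × ℕ
  | 0 => (1, 1)
  | n + 1 =>
    if n ∈ cont then
      ((progressionSeq ε ν cont n).1 + (progressionSeq ε ν cont n).2, (progressionSeq ε ν cont n).2)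
    else
      (ν n + (⌈2 * |ν n| + |(1 + ε n) * (progressionSeq ε ν cont n).1|⌉₊ + 2 : ℕ),
        ⌈2 * |ν n| + |(1 + ε n) * (progressionSeq ε ν cont n).1|⌉₊ + 2)

theorem exists_separated_positions (T N : ℕ → ℕ) :
    ∃ s : ℕ → ℕ, (∀ k, T k ≤ s k) ∧ ∀ k l, k < l → s k + N k < s l := by
  let s : ℕ → ℕ := fun k => Nat.rec (T 0) (fun k a => max (T (k + 1)) (a + N k + 1)) k
  have hs : ∀ k, s (k + 1) = max (T (k + 1)) (s k + N k + 1) := fun k => rfl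
  have hstep : ∀ k, s k + N k < s (k + 1) := fun k => by rw [hs]; omega
  have hmono : StrictMono s := strictMono_nat_of_lt_succ fun k => by have := hstep k; omega
  refine ⟨s, fun k => ?_, fun k l hkl => (hstep k).trans_le (hmono.monotone hkl)⟩
  cases k with
  | zero => exact le_rfl
  | succ k => rw [hs]; exact le_max_left _ _

/-- An almost lacunary sequence containing prescribed long arithmetic progressions. -/
theorem exists_almost_lacunary_seq {ε : ℕ → ℝ} (hpos : ∀ n, 0 < ε n)
    (hlim : Tendsto ε atTop (𝓝 0)) (N : ℕ → ℕ) (ν : ℕ → ℝ) :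
    ∃ (lam : ℕ → ℝ) (s D : ℕ → ℕ), (∀ k, D k ≠ 0) ∧
      (∀ k, ∀ j ∈ Finset.Icc 1 (N k), lam (s k + j) = ν k + D k * j) ∧
      (∀ n, 0 < lam n) ∧ (∀ n, (1 + ε n) * lam n < lam (n + 1)) ∧
      ∀ n, lam n + 1 ≤ lam (n + 1) := by
  have hT : ∀ k, ∃ T : ℕ, ∀ n ≥ T, ε n * (N k + 1) < 1 := fun k => by
    have := hlim.mul_const ((N k : ℝ) + 1)
    rw [zero_mul] at this
    exact eventually_atTop.mp (this.eventually_lt_const one_pos)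
  choose T hT using hT
  obtain ⟨s, hsT, hsN⟩ := exists_separated_positions T N
  have hinj : Function.Injective s :=
    (strictMono_nat_of_lt_succ fun k => by have := hsN k (k + 1) k.lt_succ_self; omega).injective
  -- Block `k` occupies indices `s k + 1` to `s k + N k`; the step out of `s k` starts it and the
  -- step out of `s k + N k` leaves it.
  set cont : Set ℕ := {n | ∃ k, s k < n ∧ n < s k + N k}
  have hcont : ∀ k, s k ∉ cont := by
    rintro k ⟨l, h1, h2⟩
    rcases lt_trichotomy k l with h | h | h
    · have := hsN k l h; omega
    · subst h; omega
    · have := hsN l k h; omega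
  set p := progressionSeq ε (Function.extend s ν 0) cont with hp
  have hstart : ∀ n, n ∉ cont → p (n + 1) = (Function.extend s ν 0 n +
      (⌈2 * |Function.extend s ν 0 n| + |(1 + ε n) * (p n).1|⌉₊ + 2 : ℕ),
        ⌈2 * |Function.extend s ν 0 n| + |(1 + ε n) * (p n).1|⌉₊ + 2) := fun n hn => by
    rw [hp, progressionSeq, if_neg hn]
  have hcontinue : ∀ n ∈ cont, p (n + 1) = ((p n).1 + (p n).2, (p n).2) := fun n hn => by
    rw [hp, progressionSeq, if_pos hn]
  have hDpos : ∀ n, 1 ≤ (p n).2 := by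
    intro n
    induction n with
    | zero => rw [hp, progressionSeq]
    | succ n ih =>
      by_cases h : n ∈ cont
      · rw [hcontinue n h]; exact ih
      · rw [hstart n h]; simp
  set D : ℕ → ℕ := fun k => (p (s k + 1)).2
  have hblock : ∀ k j : ℕ, 1 ≤ j → j ≤ max 1 (N k) → p (s k + j) = (ν k + D k * j, D k) := by
    intro k j hj1
    induction j, hj1 using Nat.le_induction with
    | base =>
      intro _
      have h := hstart _ (hcont k)
      ext
      · simp only [D]
        rw [h]
        simp [hinj.extend_apply]
      · rfl
    | succ j hj1 ih =>
      intro hj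
      have hmem : s k + j ∈ cont := ⟨k, by omega, by omega⟩
      rw [← add_assoc, hcontinue _ hmem, ih (by omega)]
      ext
      · push_cast; ring
      · rfl
  have hgrow : ∀ n, 0 < (p n).1 → (1 + ε n) * (p n).1 < (p (n + 1)).1 ∧
      (p n).1 + 1 ≤ (p (n + 1)).1 := by
    intro n hn
    by_cases h : n ∈ cont
    · obtain ⟨k, h1, h2⟩ := id h
      obtain ⟨j, rfl⟩ := Nat.exists_eq_add_of_le h1.le
      have hb := hblock k j (by omega) (by omega)
      have hνD : |ν k| ≤ D k := by
        have h3 := hstart _ (hcont k)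
        rw [hinj.extend_apply] at h3
        have h4 : D k = ⌈2 * |ν k| + |(1 + ε (s k)) * (p (s k)).1|⌉₊ + 2 := by
          simp only [D]; rw [h3]
        have h5 := Nat.le_ceil (2 * |ν k| + |(1 + ε (s k)) * (p (s k)).1|)
        have h6 := abs_nonneg (ν k)
        have h7 := abs_nonneg ((1 + ε (s k)) * (p (s k)).1)
        rw [h4]
        push_cast
        linarith
      have hD : (1 : ℝ) ≤ D k := by exact_mod_cast hDpos (s k + 1)
      have hε := hT k (s k + j) (by have := hsT k; omega)
      have hjN : (j : ℝ) + 1 ≤ N k + 1 := by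
        have : j ≤ N k := by omega
        have : (j : ℝ) ≤ N k := by exact_mod_cast this
        linarith
      rw [hcontinue _ h, hb]
      refine ⟨?_, by simpa using hD⟩
      -- Within a block a term is at most `D (N + 1)` since `|ν| ≤ D`; as `ε (N + 1) < 1` from index
      -- `T k` on, the increment `D` exceeds `ε` times the term.
      have h5 : ν k + D k * j ≤ D k * (N k + 1) := by
        calc ν k + D k * j ≤ D k + D k * j := by linarith [le_abs_self (ν k)]
          _ = D k * (j + 1) := by ring
          _ ≤ _ := by gcongr
      have h6 : ε (s k + j) * (ν k + D k * j) < D k := by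
        calc _ ≤ ε (s k + j) * (D k * (N k + 1)) := by gcongr; exact (hpos _).le
          _ = D k * (ε (s k + j) * (N k + 1)) := by ring
          _ < D k * 1 := by gcongr
          _ = D k := mul_one _
      simp only
      linarith
    · rw [hstart n h]
      set a := Function.extend s ν 0 n
      have h1 := Nat.le_ceil (2 * |a| + |(1 + ε n) * (p n).1|)
      have h5 := le_abs_self ((1 + ε n) * (p n).1)
      have h2 := neg_abs_le a
      have h3 := abs_nonneg a
      have h4 : 0 < ε n * (p n).1 := mul_pos (hpos n) hn
      push_cast
      constructor <;> linarith
  have hlampos : ∀ n, 0 < (p n).1 := by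
    intro n
    induction n with
    | zero => rw [hp, progressionSeq]; exact one_pos
    | succ n ih => linarith [(hgrow n ih).2]
  refine ⟨fun n => (p n).1, s, D, fun k => by have := hDpos (s k + 1); simp only [D]; omega, ?_,
    hlampos, fun n => (hgrow n (hlampos n)).1, fun n => (hgrow n (hlampos n)).2⟩
  intro k j hj
  rw [Finset.mem_Icc] at hj
  simp only
  rw [hblock k j hj.1 (by omega)]

/-! ### The Fourier transform on `L²(ℝ)`, identified by duality. -/

open scoped FourierTransform SchwartzMap ContDiff

theorem integral_mul_fourier_L2 (f : L2R) (φ : 𝓢(ℝ, ℂ)) :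
    ∫ x, φ x * (𝓕 f : L2R) x = ∫ x, 𝓕 (φ : ℝ → ℂ) x * f x := by
  have h := congrArg (fun T => T φ) (Lp.fourier_toTemperedDistribution_eq f)
  simp only [TemperedDistribution.fourier_apply, Lp.toTemperedDistribution_apply,
    smul_eq_mul] at h
  rw [← h]
  rfl

/-- The `L²` transform is pinned down by its integrals against test functions, which the
multiplication formula moves onto `f`. -/
theorem fourier_L2_ae_eq {f : L2R} {F : ℝ → ℂ} (hF : LocallyIntegrable F)
    (h : ∀ φ : ℝ → ℂ, ContDiff ℝ ∞ φ → HasCompactSupport φ →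
      ∫ x, φ x * F x = ∫ x, 𝓕 φ x * f x) : (𝓕 f : L2R) =ᵐ[volume] F := by
  refine ae_eq_of_integral_contDiff_smul_eq
    ((Lp.memLp (𝓕 f : L2R)).locallyIntegrable (by norm_num)) hF fun ψ hψ hc => ?_
  have h1 : ContDiff ℝ ∞ fun x => (ψ x : ℂ) := Complex.ofRealCLM.contDiff.comp hψ
  have h2 : HasCompactSupport fun x => (ψ x : ℂ) := hc.comp_left Complex.ofReal_zero
  have h3 := integral_mul_fourier_L2 f (h2.toSchwartzMap h1)
  simp only [Complex.real_smul]
  rw [h _ h1 h2]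
  exact h3

theorem fourier_translateL2 (f : L2R) (a : ℝ) : (𝓕 (translateL2 f a) : L2R) =ᵐ[volume]
    fun ξ => (𝐞 (-(a * ξ)) : ℂ) * (𝓕 f : L2R) ξ := by
  have hsm : ContDiff ℝ ∞ fun ξ : ℝ => (𝐞 (-(a * ξ)) : ℂ) := by
    simp only [Real.fourierChar_apply]
    exact ((Complex.ofRealCLM.contDiff.comp
      (by fun_prop : ContDiff ℝ ∞ fun ξ : ℝ => 2 * Real.pi * -(a * ξ))).mul contDiff_const).cexp
  refine fourier_L2_ae_eq ?_ fun φ hφ hc => ?_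
  · refine MemLp.locallyIntegrable (p := 2) ((Lp.memLp (𝓕 f : L2R)).mono
      (hsm.continuous.aestronglyMeasurable.mul (Lp.aestronglyMeasurable _))
      (ae_of_all _ fun ξ => ?_)) (by norm_num)
    rw [norm_mul, Circle.norm_coe, one_mul]
  · have h1 : ContDiff ℝ ∞ fun x => φ x * (𝐞 (-(a * x)) : ℂ) := hφ.mul hsm
    have h2 : HasCompactSupport fun x => φ x * (𝐞 (-(a * x)) : ℂ) := hc.mul_right
    have h3 := integral_mul_fourier_L2 f (h2.toSchwartzMap h1)
    have h4 : ∀ x, 𝓕 (fun x => φ x * (𝐞 (-(a * x)) : ℂ)) x = 𝓕 φ (x + a) := by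
      intro x
      rw [Real.fourier_real_eq, Real.fourier_real_eq]
      congr 1 with v
      rw [Circle.smul_def, Circle.smul_def, smul_eq_mul, smul_eq_mul, mul_add, neg_add,
        AddChar.map_add_eq_mul, Circle.coe_mul, mul_comm v a]
      ring
    calc ∫ x, φ x * ((𝐞 (-(a * x)) : ℂ) * (𝓕 f : L2R) x)
        = ∫ x, (φ x * (𝐞 (-(a * x)) : ℂ)) * (𝓕 f : L2R) x := by simp_rw [mul_assoc]
      _ = ∫ x, 𝓕 (fun x => φ x * (𝐞 (-(a * x)) : ℂ)) x * f x := h3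
      _ = ∫ x, 𝓕 φ (x + a) * f x := by simp_rw [h4]
      _ = ∫ x, 𝓕 φ x * f (x - a) := by
        rw [← integral_sub_right_eq_self _ a]
        simp
      _ = ∫ x, 𝓕 φ x * translateL2 f a x := by
        refine integral_congr_ae ?_
        filter_upwards [coeFn_translateL2 f a] with x hx
        rw [hx]

theorem integral_mul_fourier_integrable {F : ℝ → ℂ} (hF : Integrable F) {φ : ℝ → ℂ}
    (hφ : Integrable φ) : ∫ x, φ x * 𝓕 F x = ∫ x, 𝓕 φ x * F x := by
  have := VectorFourier.integral_fourierIntegral_smul_eq_flip (e := 𝐞) (μ := volume) (ν := volume)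
    (L := innerₗ ℝ) (f := φ) (g := F) Real.continuous_fourierChar (by fun_prop) hφ hF
  simp only [flip_innerₗ, smul_eq_mul] at this
  exact this.symm

/-- Every test function is the transform of a Schwartz function, so the multiplication formula makes
`F` integrate to zero against it. -/
theorem ae_eq_zero_of_fourier_eq_zero {F : ℝ → ℂ} (hF : Integrable F) (h : ∀ ξ, 𝓕 F ξ = 0) :
    F =ᵐ[volume] 0 := by
  refine ae_eq_zero_of_integral_contDiff_smul_eq_zero hF.locallyIntegrable fun ψ hψ hc => ?_
  have h1 : ContDiff ℝ ∞ fun x => (ψ x : ℂ) := Complex.ofRealCLM.contDiff.comp hψ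
  have h2 : HasCompactSupport fun x => (ψ x : ℂ) := hc.comp_left Complex.ofReal_zero
  set Ψ : 𝓢(ℝ, ℂ) := h2.toSchwartzMap h1
  have h3 := integral_mul_fourier_integrable hF (φ := (𝓕⁻ Ψ : 𝓢(ℝ, ℂ))) (𝓕⁻ Ψ).integrable
  rw [← SchwartzMap.fourier_coe, FourierTransform.fourier_fourierInv_eq] at h3
  simp only [h, mul_zero, integral_zero] at h3
  simp only [Complex.real_smul]
  exact h3.symm

/-! ### The unit indicator, the Bessel bound, and rational translates. -/

/-- The indicator function of `[0, 1)` as an element of `L²(ℝ)`. -/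
noncomputable def unitIndicator : L2R :=
  indicatorConstLp 2 (measurableSet_Ico (a := (0 : ℝ)) (b := 1)) (by simp) 1

theorem coeFn_unitIndicator :
    unitIndicator =ᵐ[volume] (Set.Ico (0 : ℝ) 1).indicator fun _ => (1 : ℂ) :=
  indicatorConstLp_coeFn

theorem fourier_indicator_ne_zero {ξ : ℝ} (hξ : ∀ n : ℤ, ξ ≠ n) :
    𝓕 ((Set.Ico (0 : ℝ) 1).indicator fun _ => (1 : ℂ)) ξ ≠ 0 := by
  have hξ0 : ξ ≠ 0 := by simpa using hξ 0
  have hc : -(2 * Real.pi * Complex.I * ξ) ≠ 0 := by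
    simp [Real.pi_ne_zero, hξ0]
  have h1 : 𝓕 ((Set.Ico (0 : ℝ) 1).indicator fun _ => (1 : ℂ)) ξ =
      ∫ x in (0 : ℝ)..1, Complex.exp (-(2 * Real.pi * Complex.I * ξ) * x) := by
    rw [Real.fourier_real_eq, intervalIntegral.integral_of_le zero_le_one,
      ← integral_Ico_eq_integral_Ioc, ← integral_indicator measurableSet_Ico]
    congr 1 with x
    by_cases hx : x ∈ Set.Ico (0 : ℝ) 1
    · rw [Set.indicator_of_mem hx, Set.indicator_of_mem hx, Circle.smul_def,
        Real.fourierChar_apply, smul_eq_mul, mul_one]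
      congr 1; push_cast; ring
    · rw [Set.indicator_of_notMem hx, Set.indicator_of_notMem hx, smul_zero]
  rw [h1, integral_exp_mul_complex hc]
  refine div_ne_zero ?_ hc
  intro h
  simp only [Complex.ofReal_one, mul_one, Complex.ofReal_zero, mul_zero, Complex.exp_zero,
    sub_eq_zero, Complex.exp_eq_one_iff] at h
  obtain ⟨n, hn⟩ := h
  apply hξ (-n)
  have h2 : (2 * Real.pi * Complex.I) * (ξ : ℂ) = (2 * Real.pi * Complex.I) * ((-n : ℤ) : ℂ) := by
    push_cast; linear_combination -hn
  have h3 := mul_left_cancel₀ Complex.two_pi_I_ne_zero h2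
  exact_mod_cast h3

theorem fourier_unitIndicator_ne_zero : ∀ᵐ ξ : ℝ, (𝓕 unitIndicator : L2R) ξ ≠ 0 := by
  have hFint : Integrable ((Set.Ico (0 : ℝ) 1).indicator fun _ => (1 : ℂ)) :=
    (integrable_indicator_iff measurableSet_Ico).mpr (by simp)
  have hcont : Continuous (𝓕 ((Set.Ico (0 : ℝ) 1).indicator fun _ => (1 : ℂ))) :=
    VectorFourier.fourierIntegral_continuous Real.continuous_fourierChar (by fun_prop) hFint
  have h1 : (𝓕 unitIndicator : L2R) =ᵐ[volume]
      𝓕 ((Set.Ico (0 : ℝ) 1).indicator fun _ => (1 : ℂ)) := by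
    refine fourier_L2_ae_eq hcont.locallyIntegrable fun φ hφ hc => ?_
    rw [integral_mul_fourier_integrable hFint (hφ.continuous.integrable_of_hasCompactSupport hc)]
    refine integral_congr_ae ?_
    filter_upwards [coeFn_unitIndicator] with x hx
    rw [hx]
  have h2 : ∀ᵐ ξ : ℝ, ξ ∉ Set.range ((↑) : ℤ → ℝ) :=
    (Set.countable_range _).ae_notMem volume
  filter_upwards [h1, h2] with ξ hξ1 hξ2
  rw [hξ1]
  exact fourier_indicator_ne_zero fun n hn => hξ2 ⟨n, hn.symm⟩

theorem add_one_le_of_lt {lam : ℕ → ℝ} (h : ∀ n, lam n + 1 ≤ lam (n + 1)) {m n : ℕ} (hmn : m < n) :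
    lam m + 1 ≤ lam n := by
  induction n, hmn using Nat.le_induction with
  | base => exact h m
  | succ n _ ih => linarith [h n]

theorem orthonormal_translate_unitIndicator {lam : ℕ → ℝ} (h : ∀ n, lam n + 1 ≤ lam (n + 1)) :
    Orthonormal ℂ fun n => translateL2 unitIndicator (lam n) := by
  have hcoe : ∀ a, translateL2 unitIndicator a =ᵐ[volume]
      (Set.Ico a (a + 1)).indicator fun _ => (1 : ℂ) := by
    intro a
    have h1 := (measurePreserving_sub_right volume a).quasiMeasurePreserving.ae_eq_comp
      coeFn_unitIndicator
    filter_upwards [coeFn_translateL2 unitIndicator a, h1] with t ht1 ht2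
    rw [ht1]
    simp only [Function.comp_apply] at ht2
    rw [ht2]
    have : t - a ∈ Set.Ico (0 : ℝ) 1 ↔ t ∈ Set.Ico a (a + 1) := by
      simp only [Set.mem_Ico]; constructor <;> rintro ⟨h1, h2⟩ <;> constructor <;> linarith
    by_cases ht : t ∈ Set.Ico a (a + 1)
    · rw [Set.indicator_of_mem ht, Set.indicator_of_mem (this.mpr ht)]
    · rw [Set.indicator_of_notMem ht, Set.indicator_of_notMem (fun hh => ht (this.mp hh))]
  have hzero : ∀ m n, m < n →
      inner ℂ (translateL2 unitIndicator (lam m)) (translateL2 unitIndicator (lam n)) = 0 := by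
    intro m n hmn
    rw [L2.inner_def]
    refine integral_eq_zero_of_ae ?_
    filter_upwards [hcoe (lam m), hcoe (lam n)] with t h1 h2
    rw [h1, h2]
    by_cases ht : t ∈ Set.Ico (lam m) (lam m + 1)
    · have : t ∉ Set.Ico (lam n) (lam n + 1) := fun ht' => by
        have := add_one_le_of_lt h hmn
        linarith [ht.2, ht'.1]
      simp [this]
    · simp [ht]
  refine ⟨fun n => ?_, fun m n hmn => ?_⟩
  · simp only [translateL2]
    rw [Lp.norm_compMeasurePreserving, unitIndicator, norm_indicatorConstLp (by simp) (by simp)]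
    simp
  · rcases lt_or_gt_of_ne hmn with h' | h'
    · exact hzero m n h'
    · rw [← inner_conj_symm, hzero n m h', map_zero]

theorem exists_fourier_mul {m : ℝ → ℝ} (hm : Measurable m) (hpos : ∀ ξ, 0 < m ξ)
    (hle : ∀ ξ, m ξ ≤ 1) (f : L2R) :
    ∃ f' : L2R, (𝓕 f' : L2R) =ᵐ[volume] (fun ξ => (m ξ : ℂ) * (𝓕 f : L2R) ξ) ∧ ‖f'‖ ≤ ‖f‖ := by
  have hb : ∀ ξ, ‖(m ξ : ℂ) * (𝓕 f : L2R) ξ‖ ≤ ‖(𝓕 f : L2R) ξ‖ := fun ξ => by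
    rw [norm_mul, Complex.norm_real, Real.norm_of_nonneg (hpos ξ).le]
    exact mul_le_of_le_one_left (norm_nonneg _) (hle ξ)
  have hmem : MemLp (fun ξ => (m ξ : ℂ) * (𝓕 f : L2R) ξ) 2 volume :=
    (Lp.memLp (𝓕 f : L2R)).mono
      ((Complex.measurable_ofReal.comp hm).aestronglyMeasurable.mul (Lp.aestronglyMeasurable _))
      (ae_of_all _ hb)
  have h1 : (𝓕 (𝓕⁻ hmem.toLp : L2R) : L2R) =ᵐ[volume] (fun ξ => (m ξ : ℂ) * (𝓕 f : L2R) ξ) := by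
    rw [FourierTransform.fourier_fourierInv_eq]
    exact hmem.coeFn_toLp
  refine ⟨𝓕⁻ hmem.toLp, h1, ?_⟩
  rw [← Lp.norm_fourier_eq, ← Lp.norm_fourier_eq f]
  refine Lp.norm_le_norm_of_ae_le ?_
  filter_upwards [h1] with ξ hξ
  rw [hξ]
  exact hb ξ

/-- Since `m` is real, the inner product of `f` with a translate of `g` equals that of the filtered
`f'` with a translate of the unit indicator; Bessel for an orthonormal family gives constant `1`. -/
theorem isBessel_translates {m : ℝ → ℝ} (hm : Measurable m) (hpos : ∀ ξ, 0 < m ξ)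
    (hle : ∀ ξ, m ξ ≤ 1) {lam : ℕ → ℝ} (h : ∀ n, lam n + 1 ≤ lam (n + 1)) {g : L2R}
    (hg : (𝓕 g : L2R) =ᵐ[volume] fun ξ => (m ξ : ℂ) * (𝓕 unitIndicator : L2R) ξ) :
    IsBessel fun n => translateL2 g (lam n) := by
  refine ⟨1, fun f => ?_⟩
  obtain ⟨f', hf', hnorm⟩ := exists_fourier_mul hm hpos hle f
  have horth := orthonormal_translate_unitIndicator h
  have hinner : ∀ n, ‖inner ℂ f (translateL2 g (lam n))‖ =
      ‖inner ℂ (translateL2 unitIndicator (lam n)) f'‖ := by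
    intro n
    rw [norm_inner_symm _ f', ← Lp.inner_fourier_eq, ← Lp.inner_fourier_eq f', L2.inner_def,
      L2.inner_def]
    congr 1
    refine integral_congr_ae ?_
    filter_upwards [hg, hf', fourier_translateL2 g (lam n),
      fourier_translateL2 unitIndicator (lam n)] with ξ h1 h2 h3 h4
    rw [h3, h4, h1, h2]
    simp only [RCLike.inner_apply, map_mul, Complex.conj_ofReal]
    ring
  simp_rw [hinner]
  refine ⟨horth.inner_products_summable f', ?_⟩
  rw [one_mul]
  exact Real.sqrt_le_iff.mpr ⟨norm_nonneg _, (horth.tsum_inner_products_le f').trans (by gcongr)⟩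

/-- Rational translates of a function with almost everywhere nonvanishing Fourier transform span a
dense subspace. -/
theorem span_rat_translates_dense {g : L2R} (hg : ∀ᵐ ξ : ℝ, (𝓕 g : L2R) ξ ≠ 0) :
    (Submodule.span ℂ (Set.range fun r : ℚ => translateL2 g r)).topologicalClosure = ⊤ := by
  rw [Submodule.topologicalClosure_eq_top_iff, Submodule.eq_bot_iff]
  intro h hh
  -- The inner product of `h` with the translate by `r` is `𝓕 F r`. By orthogonality this vanishes
  -- on `ℚ`, hence everywhere by continuity.
  set F : ℝ → ℂ := fun ξ => inner ℂ ((𝓕 h : L2R) ξ) ((𝓕 g : L2R) ξ) with hF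
  have hFint : Integrable F := L2.integrable_inner (𝓕 h : L2R) (𝓕 g : L2R)
  have hrat : ∀ r : ℚ, 𝓕 F r = 0 := by
    intro r
    have h1 : inner ℂ h (translateL2 g r) = 0 := by
      rw [Submodule.mem_orthogonal'] at hh
      exact hh _ (Submodule.subset_span ⟨r, rfl⟩)
    rw [← Lp.inner_fourier_eq, L2.inner_def] at h1
    rw [Real.fourier_real_eq, ← h1]
    refine integral_congr_ae ?_
    filter_upwards [fourier_translateL2 g r] with ξ hξ
    rw [hξ, Circle.smul_def, hF, mul_comm ξ]
    simp only [RCLike.inner_apply, smul_eq_mul]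
    ring
  have hcont : Continuous (𝓕 F) :=
    VectorFourier.fourierIntegral_continuous Real.continuous_fourierChar (by fun_prop) hFint
  have hzero : 𝓕 F = fun _ => 0 :=
    hcont.ext_on Rat.isDenseEmbedding_coe_real.dense continuous_const
      (by rintro _ ⟨r, rfl⟩; exact hrat r)
  have hae := ae_eq_zero_of_fourier_eq_zero hFint fun ξ => congrFun hzero ξ
  have h2 : (𝓕 h : L2R) = 0 := by
    rw [Lp.eq_zero_iff_ae_eq_zero]
    filter_upwards [hae, hg] with ξ h3 h4
    simpa [hF, h4] using h3
  rw [← norm_eq_zero, ← Lp.norm_fourier_eq, h2, norm_zero]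

/-! ### The multiplier. -/

theorem ae_coe_unitAddCircle {p : UnitAddCircle → Prop} (h : ∀ᵐ x, p x) :
    ∀ᵐ ξ : ℝ, p (ξ : UnitAddCircle) := by
  have h1 : ∀ n : ℤ, ∀ᵐ ξ : ℝ ∂(volume.restrict (Set.Ioc (n : ℝ) (n + 1))),
      p (ξ : UnitAddCircle) :=
    fun n => (UnitAddCircle.measurePreserving_mk (n : ℝ)).quasiMeasurePreserving.ae h
  rw [← Measure.restrict_univ (μ := (volume : Measure ℝ)), ← iUnion_Ioc_intCast ℝ,
    ae_restrict_iUnion_iff]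
  exact h1

theorem fourier_zsmul_coe (j : ℕ) (D : ℕ) (ξ : ℝ) :
    (fourier (j : ℤ) ((-(D : ℤ)) • (ξ : UnitAddCircle)) : ℂ) = 𝐞 (-(D * j * ξ)) := by
  rw [← fourier_mul_index, fourier_coe_apply, Real.fourierChar_apply]
  congr 1
  push_cast
  ring

/-- A positive multiplier which makes each of countably many dilated polynomials, converging to `1`
in measure, uniformly close to `1`. -/
theorem exists_multiplier {N D : ℕ → ℕ} {c : ℕ → ℕ → ℂ} (hD : ∀ k, D k ≠ 0)
    (hvol : ∀ k, volume {x : UnitAddCircle |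
      (1 / 2) ^ k < ‖∑ j ∈ Finset.Icc 1 (N k), c k j * fourier (j : ℤ) x - 1‖} ≤
        ENNReal.ofReal ((1 / 2) ^ k)) :
    ∃ m : ℝ → ℝ, Measurable m ∧ (∀ ξ, 0 < m ξ) ∧ (∀ ξ, m ξ ≤ 1) ∧ ∀ k, ∀ᵐ ξ : ℝ,
      m ξ * ‖∑ j ∈ Finset.Icc 1 (N k), c k j * (𝐞 (-(D k * j * ξ)) : ℂ) - 1‖ ≤ (1 / 2) ^ k := by
  set Q : ℕ → ℝ → ℝ := fun k ξ =>
    ‖∑ j ∈ Finset.Icc 1 (N k), c k j * (𝐞 (-(D k * j * ξ)) : ℂ) - 1‖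
  have hQ0 : ∀ k ξ, 0 ≤ 2 ^ k * Q k ξ := fun k ξ => by positivity
  have hQm : ∀ k, Measurable fun ξ => 2 ^ k * Q k ξ := fun k => by
    apply Continuous.measurable
    simp only [Q, Real.fourierChar_apply]
    fun_prop
  have hev : ∀ᵐ ξ : ℝ, ∀ᶠ k in atTop, Q k ξ ≤ (1 / 2) ^ k := by
    have h1 : ∀ᵐ x : UnitAddCircle, ∀ᶠ k in atTop, x ∉ (fun x => (-(D k : ℤ)) • x) ⁻¹'
        {x : UnitAddCircle |
          (1 / 2) ^ k < ‖∑ j ∈ Finset.Icc 1 (N k), c k j * fourier (j : ℤ) x - 1‖} := by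
      apply ae_eventually_notMem
      refine ne_top_of_le_ne_top ?_
        (ENNReal.tsum_le_tsum (g := fun k => ENNReal.ofReal ((1 / 2) ^ k)) fun k => ?_)
      · rw [← ENNReal.ofReal_tsum_of_nonneg (fun _ => by positivity) summable_geometric_two]
        exact ENNReal.ofReal_ne_top
      · rw [volume_preimage_zsmul (by simpa using hD k)]
        · exact hvol k
        · refine (isOpen_lt continuous_const ?_).measurableSet
          fun_prop
    filter_upwards [ae_coe_unitAddCircle h1] with ξ hξ
    filter_upwards [hξ] with k hk
    simp only [Set.mem_preimage, Set.mem_ofPred_eq, not_lt, fourier_zsmul_coe] at hk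
    exact hk
  have hsup0 : ∀ ξ, 0 ≤ ⨆ k, 2 ^ k * Q k ξ := fun ξ => Real.iSup_nonneg fun k => hQ0 k ξ
  -- The supremum is finite a.e. by Borel–Cantelli; on the remaining null set the real `⨆` defaults
  -- to `0`, so `m = 1` is still positive.
  refine ⟨fun ξ => 1 / (1 + ⨆ k, 2 ^ k * Q k ξ), ?_, fun ξ => ?_, fun ξ => ?_, fun k => ?_⟩
  · exact measurable_const.div (measurable_const.add (Measurable.iSup hQm))
  · have := hsup0 ξ
    positivity
  · have := hsup0 ξ
    exact div_le_one_of_le₀ (by linarith) (by linarith)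
  · filter_upwards [hev] with ξ hξ
    have hbdd : BddAbove (Set.range fun k => 2 ^ k * Q k ξ) := by
      apply IsBoundedUnder.bddAbove_range
      refine ⟨1, ?_⟩
      rw [eventually_map]
      filter_upwards [hξ] with l hl
      calc 2 ^ l * Q l ξ ≤ 2 ^ l * (1 / 2) ^ l := by gcongr
        _ = 1 := by rw [← mul_pow]; norm_num
    have h1 := le_ciSup hbdd k
    have h2 := hsup0 ξ
    set W := ⨆ k, 2 ^ k * Q k ξ
    have h3 : Q k ξ ≤ (1 / 2) ^ k * (1 + W) := by
      calc Q k ξ = (1 / 2) ^ k * (2 ^ k * Q k ξ) := by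
            rw [← mul_assoc, ← mul_pow]; norm_num
        _ ≤ (1 / 2) ^ k * (1 + W) := by gcongr; linarith
    change 1 / (1 + W) * Q k ξ ≤ (1 / 2) ^ k
    rw [one_div_mul_eq_div, div_le_iff₀ (by linarith)]
    exact h3

/-! ### From a dense span to completeness with `ℓ_q` estimate. -/

section lqNorm

variable {ι : Type*} {q : ℝ}

theorem lqNorm_eq_sum_of_subset (hq : 0 < q) {c : ι →₀ ℂ} {s : Finset ι} (hs : c.support ⊆ s) :
    lqNorm q c = (∑ i ∈ s, ‖c i‖ ^ q) ^ (1 / q) := by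
  rw [lqNorm, Finsupp.sum_of_support_subset _ hs]
  intro i _
  rw [norm_zero, Real.zero_rpow hq.ne']

theorem lqNorm_zero (hq : 0 < q) : lqNorm q (0 : ι →₀ ℂ) = 0 := by
  rw [lqNorm, Finsupp.sum_zero_index, Real.zero_rpow (by positivity)]

theorem lqNorm_add_le (hq : 1 ≤ q) (c d : ι →₀ ℂ) :
    lqNorm q (c + d) ≤ lqNorm q c + lqNorm q d := by
  classical
  have hq0 : 0 < q := by linarith
  rw [lqNorm_eq_sum_of_subset hq0 Finsupp.support_add,
    lqNorm_eq_sum_of_subset hq0 (Finset.subset_union_left (s₂ := d.support)),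
    lqNorm_eq_sum_of_subset hq0 (Finset.subset_union_right (s₁ := c.support))]
  have h := Real.Lp_add_le (c.support ∪ d.support) (fun i => ‖c i‖) (fun i => ‖d i‖) hq
  simp only [abs_norm] at h
  refine le_trans ?_ h
  gcongr with i
  rw [abs_of_nonneg (by positivity)]
  exact norm_add_le _ _

theorem lqNorm_smul (hq : 0 < q) (a : ℂ) (c : ι →₀ ℂ) : lqNorm q (a • c) = ‖a‖ * lqNorm q c := by
  rw [lqNorm_eq_sum_of_subset hq Finsupp.support_smul, lqNorm_eq_sum_of_subset hq subset_rfl]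
  simp only [Finsupp.smul_apply, smul_eq_mul, norm_mul]
  simp_rw [Real.mul_rpow (norm_nonneg _) (norm_nonneg _)]
  rw [← Finset.mul_sum, Real.mul_rpow (by positivity) (Finset.sum_nonneg fun _ _ => by positivity),
    ← Real.rpow_mul (norm_nonneg _), mul_one_div_cancel hq.ne', Real.rpow_one]

/-- If the elements of a set with dense span are limits of linear combinations of `u` whose
coefficients tend to zero in `ℓ_q`, then `u` is complete with `ℓ_q` estimate. -/
theorem completeWithLqEstimate_of_span_dense {H : Type*} [NormedAddCommGroup H]
    [InnerProductSpace ℂ H] {u : ι → H} {V : Set H}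
    (hV : (Submodule.span ℂ V).topologicalClosure = ⊤) (hq : 1 ≤ q)
    (h : ∀ v ∈ V, ∀ η > 0, ∃ c : ι →₀ ℂ,
      ‖v - c.sum (fun n z => z • u n)‖ < η ∧ lqNorm q c < η) :
    CompleteWithLqEstimate q u := by
  have hq0 : 0 < q := by linarith
  let A : Submodule ℂ H :=
    { carrier := {v | ∀ η > 0, ∃ c : ι →₀ ℂ,
        ‖v - c.sum (fun n z => z • u n)‖ < η ∧ lqNorm q c < η}
      zero_mem' := fun η hη => ⟨0, by simpa using hη, by rwa [lqNorm_zero hq0]⟩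
      add_mem' := by
        intro v w hv hw η hη
        obtain ⟨c, hc1, hc2⟩ := hv (η / 2) (by positivity)
        obtain ⟨d, hd1, hd2⟩ := hw (η / 2) (by positivity)
        refine ⟨c + d, ?_, ?_⟩
        · rw [Finsupp.sum_add_index' (by simp) (fun _ _ _ => add_smul _ _ _), add_sub_add_comm]
          linarith [norm_add_le (v - c.sum fun n z => z • u n) (w - d.sum fun n z => z • u n)]
        · linarith [lqNorm_add_le hq c d]
      smul_mem' := by
        intro a v hv η hη
        obtain ⟨c, hc1, hc2⟩ := hv (η / (‖a‖ + 1)) (by positivity)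
        have hlt : ∀ x, 0 ≤ x → x < η / (‖a‖ + 1) → ‖a‖ * x < η := by
          intro x hx hx'
          rw [lt_div_iff₀ (by positivity)] at hx'
          linarith
        refine ⟨a • c, ?_, ?_⟩
        · rw [Finsupp.sum_smul_index' (by simp)]
          simp_rw [smul_assoc]
          rw [← Finsupp.smul_sum, ← smul_sub, norm_smul]
          exact hlt _ (norm_nonneg _) hc1
        · rw [lqNorm_smul hq0]
          refine hlt _ ?_ hc2
          exact Real.rpow_nonneg (Finset.sum_nonneg fun _ _ => by positivity) _ }
  have hVA : Submodule.span ℂ V ≤ A := Submodule.span_le.mpr h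
  refine ⟨1, fun f ε hε => ?_⟩
  rcases eq_or_ne f 0 with rfl | hf
  · exact ⟨0, by simpa using hε, by simp [lqNorm_zero hq0]⟩
  have hf0 : 0 < ‖f‖ := norm_pos_iff.mpr hf
  have hfcl : f ∈ (Submodule.span ℂ V).topologicalClosure := hV ▸ Submodule.mem_top
  rw [← SetLike.mem_coe, Submodule.topologicalClosure_coe, Metric.mem_closure_iff] at hfcl
  obtain ⟨w, hw, hfw⟩ := hfcl (ε / 2) (by positivity)
  -- Coefficients can be made arbitrarily small, in particular below `‖f‖`, so the constant `1`
  -- works; this is why `f = 0` was treated apart.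
  obtain ⟨c, hc1, hc2⟩ := hVA hw (min (ε / 2) ‖f‖) (by positivity)
  refine ⟨c, ?_, by linarith [min_le_right (ε / 2) ‖f‖]⟩
  rw [dist_eq_norm] at hfw
  linarith [norm_sub_le_norm_sub_add_norm_sub f w (c.sum fun n z => z • u n),
    min_le_left (ε / 2) ‖f‖]

end lqNorm

/-! ### Assembly. -/

theorem exists_seq_rat_frequently : ∃ ν : ℕ → ℚ, ∀ r K, ∃ k ≥ K, ν k = r := by
  obtain ⟨e, he⟩ := exists_surjective_nat ℚ
  refine ⟨fun k => e k.unpair.1, fun r K => ?_⟩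
  obtain ⟨a, rfl⟩ := he r
  exact ⟨Nat.pair a K, Nat.right_le_pair a K, by simp⟩

/-- Error of the approximation of a translate by translates along an arithmetic progression. -/
theorem norm_translate_sub_sum_le {m : ℝ → ℝ} (hpos : ∀ ξ, 0 < m ξ) {g : L2R}
    (hg : (𝓕 g : L2R) =ᵐ[volume] fun ξ => (m ξ : ℂ) * (𝓕 unitIndicator : L2R) ξ)
    {N D : ℕ} {c : ℕ → ℂ} {δ : ℝ}
    (hδ : ∀ᵐ ξ : ℝ, m ξ * ‖∑ j ∈ Finset.Icc 1 N, c j * (𝐞 (-(D * j * ξ)) : ℂ) - 1‖ ≤ δ) (r : ℝ) :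
    ‖translateL2 g r - ∑ j ∈ Finset.Icc 1 N, c j • translateL2 g (r + D * j)‖ ≤
      δ * ‖unitIndicator‖ := by
  rw [← Lp.norm_fourier_eq, ← Lp.norm_fourier_eq unitIndicator]
  refine Lp.norm_le_mul_norm_of_ae_le_mul ?_
  have hF : (𝓕 (translateL2 g r - ∑ j ∈ Finset.Icc 1 N, c j • translateL2 g (r + D * j)) : L2R) =
      𝓕 (translateL2 g r) - ∑ j ∈ Finset.Icc 1 N, c j • (𝓕 (translateL2 g (r + D * j)) : L2R) := by
    change Lp.fourierTransformₗᵢ ℝ ℂ _ = _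
    rw [map_sub, map_sum]
    simp_rw [map_smul]
    rfl
  have h1 : ∀ᵐ ξ : ℝ, ∀ j : ℕ, (𝓕 (translateL2 g (r + D * j)) : L2R) ξ =
      (𝐞 (-((r + D * j) * ξ)) : ℂ) * (𝓕 g : L2R) ξ :=
    ae_all_iff.mpr fun j => fourier_translateL2 g _
  have h2 : ∀ᵐ ξ : ℝ, ∀ j : ℕ, (c j • (𝓕 (translateL2 g (r + D * j)) : L2R) : L2R) ξ =
      c j * (𝓕 (translateL2 g (r + D * j)) : L2R) ξ :=
    ae_all_iff.mpr fun j => Lp.coeFn_smul _ _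
  rw [hF]
  filter_upwards [hg, hδ, h1, h2, fourier_translateL2 g r,
    Lp.coeFn_sub (𝓕 (translateL2 g r) : L2R)
      (∑ j ∈ Finset.Icc 1 N, c j • (𝓕 (translateL2 g (r + D * j)) : L2R)),
    Lp.coeFn_finsetSum (Finset.Icc 1 N)
      fun j : ℕ => c j • (𝓕 (translateL2 g (r + D * j)) : L2R)] with ξ e1 e2 e3 e4 e5 e6 e7
  rw [e6, Pi.sub_apply, e7, Finset.sum_apply, e5]
  simp_rw [e4, e3]
  -- The common character of modulus one factors out, leaving the polynomial minus `1` times `𝓕 g`,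
  -- where the weight `m` makes it at most `δ`.
  have h3 : (𝐞 (-(r * ξ)) : ℂ) * (𝓕 g : L2R) ξ -
      ∑ j ∈ Finset.Icc 1 N, c j * ((𝐞 (-((r + D * j) * ξ)) : ℂ) * (𝓕 g : L2R) ξ) =
      -((𝐞 (-(r * ξ)) : ℂ) * (∑ j ∈ Finset.Icc 1 N, c j * (𝐞 (-(D * j * ξ)) : ℂ) - 1) *
        (𝓕 g : L2R) ξ) := by
    have h4 : ∀ j : ℕ, (𝐞 (-((r + D * j) * ξ)) : ℂ) = 𝐞 (-(r * ξ)) * 𝐞 (-(D * j * ξ)) := by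
      intro j
      rw [← Circle.coe_mul, ← AddChar.map_add_eq_mul]
      congr 2; ring
    simp_rw [h4]
    rw [mul_sub, sub_mul, Finset.mul_sum, Finset.sum_mul, mul_one, neg_sub]
    congr 1
    refine Finset.sum_congr rfl fun j _ => ?_
    ring
  rw [h3, norm_neg, norm_mul, norm_mul, Circle.norm_coe, one_mul, e1, norm_mul, Complex.norm_real,
    Real.norm_of_nonneg (hpos ξ).le, ← mul_assoc, mul_comm _ (m ξ)]
  gcongr

theorem theorem2 (ε : ℕ → ℝ) (hpos : ∀ n, 0 < ε n) (hlim : Tendsto ε atTop (𝓝 0)) :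
    ∃ (lam : ℕ → ℝ) (g : L2R),
      (∀ n, 0 < lam n) ∧
      (∀ n, lam (n + 1) / lam n > 1 + ε n) ∧
      UniformlyDiscrete (Set.range lam) ∧
      IsQF (fun n => translateL2 g (lam n)) := by
  obtain ⟨ν, hν⟩ := exists_seq_rat_frequently
  -- Exponents decreasing to `2` let one sequence serve every `q > 2`: eventually `2 + 1/(k+1) < q`,
  -- and coefficients of modulus at most `1` have a smaller sum at the larger exponent.
  have hA : ∀ k : ℕ, _ := fun k => exists_analytic_trigPoly_near_one_lq
    (q := 2 + 1 / ((k : ℝ) + 1)) (η := (1 / 2) ^ k) (lt_add_of_pos_right 2 (by positivity))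
    (by positivity)
  choose N c hcq hvol using hA
  obtain ⟨lam, s, D, hD, hlam, hlpos, hratio, hgap⟩ :=
    exists_almost_lacunary_seq hpos hlim N fun k => (ν k : ℝ)
  obtain ⟨m, hm, hmpos, hmle, hmul⟩ := exists_multiplier hD hvol
  obtain ⟨g, hg, -⟩ := exists_fourier_mul hm hmpos hmle unitIndicator
  refine ⟨lam, g, hlpos, fun n => (lt_div_iff₀ (hlpos n)).mpr (hratio n), ⟨1, one_pos, ?_⟩,
    fun q hq => ?_, isBessel_translates hm hmpos hmle hgap hg⟩
  · rintro _ ⟨a, rfl⟩ _ ⟨b, rfl⟩ hab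
    rcases lt_trichotomy a b with h | h | h
    · rw [abs_sub_comm]
      exact le_trans (by linarith [add_one_le_of_lt hgap h]) (le_abs_self _)
    · exact absurd (congrArg lam h) hab
    · exact le_trans (by linarith [add_one_le_of_lt hgap h]) (le_abs_self _)
  have hgne : ∀ᵐ ξ : ℝ, (𝓕 g : L2R) ξ ≠ 0 := by
    filter_upwards [hg, fourier_unitIndicator_ne_zero] with ξ h1 h2
    rw [h1]
    exact mul_ne_zero (Complex.ofReal_ne_zero.mpr (hmpos ξ).ne') h2
  refine completeWithLqEstimate_of_span_dense (span_rat_translates_dense hgne) (by linarith) ?_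
  rintro _ ⟨r, rfl⟩ η hη
  have hq0 : 0 < q := by linarith
  have hpow : Tendsto (fun k : ℕ => (1 / 2 : ℝ) ^ k) atTop (𝓝 0) :=
    tendsto_pow_atTop_nhds_zero_of_lt_one (by norm_num) (by norm_num)
  obtain ⟨K, hK⟩ := eventually_atTop.mp
    (((hpow.eventually_lt_const (show 0 < η / (‖unitIndicator‖ + 1) by positivity)).and
      (hpow.eventually_lt_const (show 0 < η ^ q by positivity))).and
      (tendsto_one_div_add_atTop_nhds_zero_nat.eventually_lt_const (sub_pos.mpr hq)))
  obtain ⟨k, hkK, hk⟩ := hν r K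
  obtain ⟨⟨hk1, hk2⟩, hk3⟩ := hK k hkK
  set T := (Finset.Icc 1 (N k)).map (addLeftEmbedding (s k))
  set d : ℕ →₀ ℂ := Finsupp.indicator T fun i _ => c k (i - s k)
  have hdT : d.support ⊆ T := Finsupp.support_indicator_subset _ _
  have hd : ∀ j ∈ Finset.Icc 1 (N k), d (s k + j) = c k j := by
    intro j hj
    have hmem : s k + j ∈ T := Finset.mem_map.mpr ⟨j, hj, rfl⟩
    rw [Finsupp.indicator_of_mem hmem, Nat.add_sub_cancel_left]
  refine ⟨d, ?_, ?_⟩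
  · rw [Finsupp.sum_of_support_subset _ hdT _ (by simp), Finset.sum_map]
    have h1 : ∑ j ∈ Finset.Icc 1 (N k), d (addLeftEmbedding (s k) j) •
        translateL2 g (lam (addLeftEmbedding (s k) j)) =
        ∑ j ∈ Finset.Icc 1 (N k), c k j • translateL2 g ((r : ℝ) + D k * j) := by
      refine Finset.sum_congr rfl fun j hj => ?_
      rw [addLeftEmbedding_apply, hd j hj, hlam k j hj, hk]
    rw [h1]
    refine (norm_translate_sub_sum_le hmpos hg (hmul k) r).trans_lt ?_
    rw [lt_div_iff₀ (by positivity)] at hk1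
    have : 0 < (1 / 2 : ℝ) ^ k := by positivity
    linarith
  · rw [lqNorm_eq_sum_of_subset hq0 hdT, Finset.sum_map]
    have h1 : ∑ j ∈ Finset.Icc 1 (N k), ‖d (addLeftEmbedding (s k) j)‖ ^ q ≤ (1 / 2) ^ k := by
      refine (Finset.sum_le_sum fun j hj => ?_).trans (hcq k)
      rw [addLeftEmbedding_apply, hd j hj]
      have h2 : 0 < 2 + 1 / ((k : ℝ) + 1) := by positivity
      have h3 : ‖c k j‖ ≤ 1 := by
        by_contra hcon
        have h4 := Real.one_lt_rpow (not_le.mp hcon) h2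
        have h5 := Finset.single_le_sum (f := fun j => ‖c k j‖ ^ (2 + 1 / ((k : ℝ) + 1)))
          (fun _ _ => by positivity) hj
        have h6 : (1 / 2 : ℝ) ^ k ≤ 1 := pow_le_one₀ (by norm_num) (by norm_num)
        linarith [hcq k]
      rcases eq_or_lt_of_le (norm_nonneg (c k j)) with h0 | h0
      · rw [← h0, Real.zero_rpow hq0.ne', Real.zero_rpow h2.ne']
      · exact Real.rpow_le_rpow_of_exponent_ge h0 h3 (by linarith)
    calc _ ≤ ((1 / 2 : ℝ) ^ k) ^ (1 / q) := by gcongr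
      _ < (η ^ q) ^ (1 / q) := by gcongr
      _ = η := by rw [← Real.rpow_mul hη.le, mul_one_div_cancel hq0.ne', Real.rpow_one]
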